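/- For $k\ge 0$ define $2^k\times 2^k$ matrices $A_k$ with entries in $\mathbb Z[v,x,y]$ by $A_0=\begin{bmatrix}1\end{bmatrix}$, $A_1=\begin{bmatrix} v&1\\ y&0\end{bmatrix}$ and, for $k\ge 2$, $$A_k=\begin{bmatrix} vA_{k-1}+x\begin{bmatrix}A_{k-2}&0\\0&0\end{bmatrix} & A_{k-1}\\ yA_{k-1}&0\end{bmatrix},$$ where each $0$ is a square zero matrix of the fitting size. Let $\mathbb Z_{m\times n}$ be the rectangular grid graph with $m$ columns and $n$ rows of vertices. A monomer–dimer covering of it is a set of edges (dimers) such that no vertex belongs to more than one of them; the vertices that belong to no dimer are its monomers. Theorem. Let $m$ and $n$ be odd positive integers and let $G^s_{m\times n}(v,x,y)$ be the $(2,1)$-entry of $(A_m)^n$. Let $p$ be any vertex on the boundary of $\mathbb Z_{m\times n}$ whose column number and row number (each counted from $1$) are both odd. Then $G^s_{m\times n}(0,1,1)$ is the number of monomer–dimer coverings of $\mathbb Z_{m\times n}$ whose only monomer is $p$; in particular this number does not depend on $p$, and $p$ may be the corner. Moreover, for every $k\in\{0,2,4,\dots,m-1\}$ and every $(i,j)$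 with $\{i,j\}=\{1,2^k+1\}$, the $(i,j)$-entry of $(A_m)^n$, evaluated at $(v,x,y)=(0,1,1)$, is equal to this same number. -/

import Mathlib

/-- The identification of two consecutive runs of `2 ^ k` indices with the `2 ^ (k + 1)` indices:
the first summand is the first half, the second summand is the second half. -/
def halves (k : ℕ) : Fin (2 ^ k) ⊕ Fin (2 ^ k) ≃ Fin (2 ^ (k + 1)) :=
  finSumFinEquiv.trans (finCongr (by rw [pow_succ]; omega))

/-- The `2 ^ (k + 1) × 2 ^ (k + 1)` matrix with the four given `2 ^ k × 2 ^ k` blocks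
(upper left, upper right, lower left, lower right). -/
def blocks {R : Type*} {k : ℕ} (P Q S T : Matrix (Fin (2 ^ k)) (Fin (2 ^ k)) R) :
    Matrix (Fin (2 ^ (k + 1))) (Fin (2 ^ (k + 1))) R :=
  Matrix.reindex (halves k) (halves k) (Matrix.fromBlocks P Q S T)

/-- The recursively defined `2 ^ m × 2 ^ m` matrix `A_m`, with monomer activity `v` and activities
`x`, `y` of horizontal and vertical dimers. -/
def barMatrix {R : Type*} [CommSemiring R] (v x y : R) :
    (m : ℕ) → Matrix (Fin (2 ^ m)) (Fin (2 ^ m)) R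
  | 0 => (!![1] : Matrix (Fin 1) (Fin 1) R)
  | 1 => (!![v, 1; y, 0] : Matrix (Fin 2) (Fin 2) R)
  | k + 2 =>
      blocks (v • barMatrix v x y (k + 1) + x • blocks (barMatrix v x y k) 0 0 0)
        (barMatrix v x y (k + 1))
        (y • barMatrix v x y (k + 1)) 0

/-- The matrix `(A_m) ^ n`, whose entries are polynomials in the three
indeterminates `v = X 0`, `x = X 1`, `y = X 2`. -/
noncomputable def stateMatrix (m n : ℕ) :
    Matrix (Fin (2 ^ m)) (Fin (2 ^ m)) (MvPolynomial (Fin 3) ℤ) :=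
  barMatrix (MvPolynomial.X 0) (MvPolynomial.X 1) (MvPolynomial.X 2) m ^ n

/-- The first row or column index (written `1` when indices are counted from one). -/
def firstIndex (m : ℕ) : Fin (2 ^ m) := ⟨0, Nat.two_pow_pos m⟩

/-- The row or column index written `2 ^ k + 1` when indices are counted from one. -/
def powIndex (m k : ℕ) (hk : k < m) : Fin (2 ^ m) :=
  ⟨2 ^ k, Nat.pow_lt_pow_right one_lt_two hk⟩

/-- The `(2, 1)`-entry of `(A_m) ^ n` (indices counted from one), a polynomial in `v, x, y`. -/
noncomputable def singleMonomerPoly (m n : ℕ) (hm : 0 < m) : MvPolynomial (Fin 3) ℤ :=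
  stateMatrix m n ⟨1, Nat.one_lt_two_pow hm.ne'⟩ (firstIndex m)

/-- The `m × n` rectangular grid on the square lattice, with `m` columns and `n` rows;
the vertex `(a, b)` lies in the column `a` from the left and the row `b` from the bottom,
counted from zero. -/
def grid (m n : ℕ) : SimpleGraph (Fin m × Fin n) :=
  (SimpleGraph.pathGraph m).boxProd (SimpleGraph.pathGraph n)

/-- A monomer-dimer covering of a graph, given by its set of dimers: the dimers are edges, and
no vertex belongs to more than one of them. -/
def IsMonomerDimerCovering {V : Type*} (G : SimpleGraph V) (D : Set (Sym2 V)) : Prop :=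
  D ⊆ G.edgeSet ∧ ∀ w : V, ∀ d ∈ D, ∀ e ∈ D, w ∈ d → w ∈ e → d = e

/-- The monomers of a covering: the vertices that belong to no dimer. -/
def monomers {V : Type*} (D : Set (Sym2 V)) : Set V := {w | ∀ d ∈ D, w ∉ d}

/-- The number of monomer-dimer coverings of the `m × n` grid that have a monomer at `p` and
no other monomer. -/
noncomputable def singleMonomerCount (m n : ℕ) (p : Fin m × Fin n) : ℕ :=
  Set.ncard {D : Set (Sym2 (Fin m × Fin n)) |
    IsMonomerDimerCovering (grid m n) D ∧ monomers D = {p}}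

/-- The vertex `p` lies on the boundary of the `m × n` grid. -/
def IsBoundarySite {m n : ℕ} (p : Fin m × Fin n) : Prop :=
  (p.1 : ℕ) = 0 ∨ (p.1 : ℕ) + 1 = m ∨ (p.2 : ℕ) = 0 ∨ (p.2 : ℕ) + 1 = n

/-- Both coordinates of the vertex `p`, counted from one, are odd. -/
def HasOddCoordinates {m n : ℕ} (p : Fin m × Fin n) : Prop :=
  Odd ((p.1 : ℕ) + 1) ∧ Odd ((p.2 : ℕ) + 1)

/-! ### Block matrices of size a power of two -/

section Blocks

variable {R : Type*}

/-! At `(0,1,1)` the entry of `A_m ^ n` in row `s` and the first column counts the dimer coverings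
of `n` rows with the columns in the binary digits of `s` missing from the last row
(`profileCount_eq_barMatrix_pow`). So the entries `a k` at row index `2 ^ k` of the first column
count coverings with a single monomer on an outer row.

The transfer matrix is free-fermionic: a Jordan-Wigner operator passes through it up to sign, with
its coefficients changed linearly (`barMatrix_mul_fermion`). Starting from annihilators with
coefficients `v`, `n` passages give annihilation coefficients `F (n+1) v`, where `F` are the
Fibonacci polynomials in a real symmetric matrix `H`. Annihilators kill the empty state, so
comparing entries at the first index gives `a ⬝ᵥ F (n+1) v = 0` for all `v`. For odd `n`, `F (n+1) =
H P` with `P` positive definite and commuting with `H`; taking `v = H a` forces `H a = 0`, which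
says that entries of `a` two apart agree.

Reflection and transposition of the grid carry this equality to all four sides through a shared
corner; symmetry of the transfer matrix gives the transposed entries. -/

theorem blocks_mul [CommRing R] {k : ℕ} (P Q S T P' Q' S' T' : Matrix (Fin (2 ^ k)) (Fin (2 ^ k)) R) :
    blocks P Q S T * blocks P' Q' S' T' =
      blocks (P * P' + Q * S') (P * Q' + Q * T') (S * P' + T * S') (S * Q' + T * T') := by
  simp only [blocks, Matrix.reindex_apply, Matrix.submatrix_mul_equiv, Matrix.fromBlocks_multiply]

theorem blocks_add [CommRing R] {k : ℕ} (P Q S T P' Q' S' T' : Matrix (Fin (2 ^ k)) (Fin (2 ^ k)) R) :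
    blocks P Q S T + blocks P' Q' S' T' = blocks (P + P') (Q + Q') (S + S') (T + T') := by
  simp only [blocks, Matrix.reindex_apply, ← Matrix.fromBlocks_add, Matrix.submatrix_add]
  rfl

theorem blocks_smul [CommRing R] {k : ℕ} (c : R) (P Q S T : Matrix (Fin (2 ^ k)) (Fin (2 ^ k)) R) :
    c • blocks P Q S T = blocks (c • P) (c • Q) (c • S) (c • T) := by
  simp only [blocks, Matrix.reindex_apply, ← Matrix.fromBlocks_smul, Matrix.submatrix_smul]
  rfl

theorem blocks_transpose {k : ℕ} (P Q S T : Matrix (Fin (2 ^ k)) (Fin (2 ^ k)) R) :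
    (blocks P Q S T).transpose = blocks P.transpose S.transpose Q.transpose T.transpose := by
  simp only [blocks, Matrix.transpose_reindex, Matrix.fromBlocks_transpose]

theorem blocks_map {R' : Type*} {k : ℕ} (f : R → R') (P Q S T : Matrix (Fin (2 ^ k)) (Fin (2 ^ k)) R) :
    (blocks P Q S T).map f = blocks (P.map f) (Q.map f) (S.map f) (T.map f) := by
  simp only [blocks, Matrix.reindex_apply, ← Matrix.fromBlocks_map, Matrix.submatrix_map]

theorem blocks_apply_inl_inl {k : ℕ} (P Q S T : Matrix (Fin (2 ^ k)) (Fin (2 ^ k)) R) (i j) :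
    blocks P Q S T (halves k (.inl i)) (halves k (.inl j)) = P i j := by simp [blocks]

theorem blocks_apply_inl_inr {k : ℕ} (P Q S T : Matrix (Fin (2 ^ k)) (Fin (2 ^ k)) R) (i j) :
    blocks P Q S T (halves k (.inl i)) (halves k (.inr j)) = Q i j := by simp [blocks]

theorem blocks_apply_inr_inl {k : ℕ} (P Q S T : Matrix (Fin (2 ^ k)) (Fin (2 ^ k)) R) (i j) :
    blocks P Q S T (halves k (.inr i)) (halves k (.inl j)) = S i j := by simp [blocks]

theorem blocks_apply_inr_inr {k : ℕ} (P Q S T : Matrix (Fin (2 ^ k)) (Fin (2 ^ k)) R) (i j) :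
    blocks P Q S T (halves k (.inr i)) (halves k (.inr j)) = T i j := by simp [blocks]

theorem halves_inl_val {k : ℕ} (i : Fin (2 ^ k)) : (halves k (.inl i) : ℕ) = i := by simp [halves]

theorem halves_inr_val {k : ℕ} (i : Fin (2 ^ k)) : (halves k (.inr i) : ℕ) = 2 ^ k + i := by
  simp [halves, add_comm]

theorem firstIndex_succ (k : ℕ) : firstIndex (k + 1) = halves k (.inl (firstIndex k)) :=
  Fin.ext (by rw [halves_inl_val]; rfl)

theorem sum_halves {M : Type*} [AddCommMonoid M] {k : ℕ} (f : Fin (2 ^ (k + 1)) → M) :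
    ∑ i, f i = ∑ i, f (halves k (.inl i)) + ∑ i, f (halves k (.inr i)) := by
  rw [← (halves k).sum_comp, Fintype.sum_sum_type]

end Blocks

/-! ### The transfer matrix and its fermions -/

section BarMatrix

variable {R : Type*} [CommRing R]

theorem barMatrix_map {R' : Type*} [CommRing R'] (f : R →+* R') (v x y : R) :
    ∀ m, (barMatrix v x y m).map f = barMatrix (f v) (f x) (f y) m
  | 0 => by ext i j; fin_cases i; fin_cases j; simp [barMatrix]
  | 1 => by ext i j; fin_cases i <;> fin_cases j <;> simp [barMatrix]
  | k + 2 => by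
    simp only [barMatrix, blocks_map]
    rw [← barMatrix_map f v x y k, ← barMatrix_map f v x y (k + 1)]
    congr 1
    · rw [Matrix.map_add _ (map_add f)]
      congr 1
      · ext; simp
      · rw [Matrix.map_zero _ (map_zero f) |>.symm, ← blocks_map]
        ext; simp
    · ext; simp
    · ext; simp

/-- The contribution of the horizontal dimers in the last two columns. -/
def cornerBlock (R : Type*) [CommRing R] : (m : ℕ) → Matrix (Fin (2 ^ m)) (Fin (2 ^ m)) R
  | 0 => 0
  | k + 1 => blocks (barMatrix 0 1 1 k) 0 0 0

/-- Without monomers the recursion takes one uniform shape, valid from `m = 0`, which later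
inductions use. -/
theorem barMatrix_succ : ∀ m : ℕ, barMatrix (0 : R) 1 1 (m + 1) =
    blocks (cornerBlock R m) (barMatrix 0 1 1 m) (barMatrix 0 1 1 m) 0
  | 0 => by
    ext i j
    obtain ⟨i, rfl⟩ := (halves 0).surjective i
    obtain ⟨j, rfl⟩ := (halves 0).surjective j
    rcases i with i | i <;> rcases j with j | j <;> fin_cases i <;> fin_cases j <;>
      simp [blocks, cornerBlock, barMatrix, halves] <;> rfl
  | k + 1 => by simp [barMatrix, cornerBlock]

theorem barMatrix_transpose : ∀ m : ℕ, (barMatrix (0 : R) 1 1 m).transpose = barMatrix 0 1 1 m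
  | 0 => by ext i j; fin_cases i; fin_cases j; rfl
  | 1 => by ext i j; fin_cases i <;> fin_cases j <;> rfl
  | k + 2 => by
    simp only [barMatrix_succ (k + 1), cornerBlock, blocks_transpose, barMatrix_transpose k,
      barMatrix_transpose (k + 1), Matrix.transpose_zero]

/-- The Jordan-Wigner fermion operator `∑ k, (u k • c k + w k • (c k)ᵀ)` on `m` sites. -/
def fermion (u w : ℕ → R) : (m : ℕ) → Matrix (Fin (2 ^ m)) (Fin (2 ^ m)) R
  | 0 => 0
  | k + 1 => blocks (fermion u w k) (u k • 1) (w k • 1) (-1 • fermion u w k)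

theorem fermion_congr {u w u' w' : ℕ → R} : ∀ {m : ℕ}, (∀ k < m, u k = u' k) →
    (∀ k < m, w k = w' k) → fermion u w m = fermion u' w' m
  | 0, _, _ => rfl
  | k + 1, hu, hw => by
    simp only [fermion]
    rw [hu k (by omega), hw k (by omega), fermion_congr (m := k) (fun i hi => hu i (by omega))
      (fun i hi => hw i (by omega))]

/-- The value at the left neighbour. -/
def leftValue (u : ℕ → R) (k : ℕ) : R := if k = 0 then 0 else u (k - 1)

/-- The corner block enters the recursion, so its own relation with the fermion must be proved in
the same induction. The excess term `u m • cornerBlock R m` comes from the neighbour beyond the last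
column and vanishes once `u m = 0`. -/
theorem barMatrix_mul_fermion_aux (u w : ℕ → R) (u' w' : ℕ → R)
    (hu : ∀ k, u' k = (-1) ^ (k + 1) * (w k + leftValue u k - u (k + 1)))
    (hw : ∀ k, w' k = (-1) ^ (k + 1) * u k) : ∀ m : ℕ,
    barMatrix 0 1 1 m * fermion u w m =
      (-1 : R) ^ m • (fermion u' w' m * barMatrix 0 1 1 m) + u m • cornerBlock R m ∧
    cornerBlock R m * fermion u w m + (-1 : R) ^ m • (fermion u' w' m * cornerBlock R m) =
      leftValue u m • barMatrix 0 1 1 m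
  | 0 => by simp [fermion, cornerBlock, leftValue]
  | m + 1 => by
    obtain ⟨h1, h2⟩ := barMatrix_mul_fermion_aux u w u' w' hu hw m
    rw [barMatrix_succ, cornerBlock]
    simp only [fermion, blocks_mul, blocks_smul, blocks_add, hu, hw]
    -- With the sign fixed to `1` or `-1`, each block becomes a linear consequence of `h1` or `h2`.
    rcases neg_one_pow_eq_or R m with hε | hε <;>
    · simp only [hε, pow_succ, leftValue, Nat.add_sub_cancel, Nat.add_eq_zero_iff, one_ne_zero,
        and_false, if_false, Matrix.mul_smul, Matrix.smul_mul, mul_one, one_mul, Matrix.mul_zero, Matrix.zero_mul] at h1 h2 ⊢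
      constructor
      · congr 1
        · linear_combination (norm := module) h2
        · linear_combination (norm := module) -h1
        · linear_combination (norm := module) h1
        · module
      · congr 1
        · linear_combination (norm := module) h1
        · module
        · module
        · module

/-- A fermion can be moved through the transfer matrix. -/
theorem barMatrix_mul_fermion (m : ℕ) (u w u' w' : ℕ → R) (hm : u m = 0)
    (hu : ∀ k < m, u' k = (-1) ^ (k + 1) * (w k + leftValue u k - u (k + 1)))
    (hw : ∀ k < m, w' k = (-1) ^ (k + 1) * u k) :
    barMatrix 0 1 1 m * fermion u w m =
      (-1 : R) ^ m • (fermion u' w' m * barMatrix 0 1 1 m) := by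
  rw [(barMatrix_mul_fermion_aux u w _ _ (fun _ => rfl) (fun _ => rfl) m).1, hm, zero_smul,
    add_zero, fermion_congr hu hw]

theorem fermion_zero_apply_firstIndex (u : ℕ → R) : ∀ (m : ℕ) (i : Fin (2 ^ m)),
    fermion u 0 m i (firstIndex m) = 0
  | 0, i => rfl
  | k + 1, i => by
    obtain ⟨i, rfl⟩ := (halves k).surjective i
    rw [firstIndex_succ]
    rcases i with i | i <;>
      simp [fermion, blocks_apply_inl_inl, blocks_apply_inr_inl, fermion_zero_apply_firstIndex u k]

/-- The row of the empty state meets only one-particle states, and with no other particle present no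
Jordan-Wigner sign appears. -/
theorem sum_fermion_firstIndex_mul (u w : ℕ → R) (f : ℕ → R) : ∀ m : ℕ,
    ∑ j : Fin (2 ^ m), fermion u w m (firstIndex m) j * f j = ∑ k ∈ Finset.range m, u k * f (2 ^ k)
  | 0 => by simp [fermion]
  | m + 1 => by
    rw [sum_halves, firstIndex_succ, Finset.sum_range_succ, ← sum_fermion_firstIndex_mul u w f m]
    simp [fermion, blocks_apply_inl_inl, blocks_apply_inl_inr, halves_inl_val, halves_inr_val,
      Matrix.one_apply, firstIndex]

end BarMatrix

/-! ### Positivity of Fibonacci polynomials of a symmetric matrix -/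

section Fibonacci

/-- The Fibonacci polynomials evaluated at a matrix. -/
def fibMatrix {ι R : Type*} [Fintype ι] [DecidableEq ι] [CommRing R] (H : Matrix ι ι R) :
    ℕ → Matrix ι ι R
  | 0 => 0
  | 1 => 1
  | r + 2 => H * fibMatrix H (r + 1) + fibMatrix H r

variable {ι : Type*} [Fintype ι] [DecidableEq ι]

/-- Odd Fibonacci polynomials are even with positive constant term, and even ones are the variable
times such a polynomial; the recursion adds `H P Hᵀ`, which is positive semidefinite. -/
theorem posDef_fibMatrix (H : Matrix ι ι ℝ) (hH : H.transpose = H) : ∀ r : ℕ,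
    ((fibMatrix H (2 * r + 1)).PosDef ∧ Commute H (fibMatrix H (2 * r + 1))) ∧
    ∃ P : Matrix ι ι ℝ, P.PosDef ∧ Commute H P ∧ fibMatrix H (2 * r + 2) = H * P
  | 0 => by
    refine ⟨⟨?_, ?_⟩, 1, Matrix.PosDef.one, Commute.one_right _, ?_⟩ <;>
      simp [fibMatrix, Matrix.PosDef.one]
  | r + 1 => by
    obtain ⟨⟨h1, h2⟩, P, hP, hc, hPe⟩ := posDef_fibMatrix H hH r
    have key : fibMatrix H (2 * (r + 1) + 1) = H * P * H.conjTranspose + fibMatrix H (2 * r + 1) := by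
      change H * fibMatrix H (2 * r + 2) + _ = _
      rw [hPe, Matrix.conjTranspose_eq_transpose_of_trivial, hH, mul_assoc, hc.eq]
      rfl
    have hp : (fibMatrix H (2 * (r + 1) + 1)).PosDef := by
      rw [key]
      exact h1.posSemidef_add (hP.posSemidef.mul_mul_conjTranspose_same H)
    have hcomm : Commute H (fibMatrix H (2 * (r + 1) + 1)) := by
      rw [key, Matrix.conjTranspose_eq_transpose_of_trivial, hH]
      exact (((Commute.refl H).mul_right hc).mul_right (Commute.refl H)).add_right h2
    refine ⟨⟨hp, hcomm⟩, fibMatrix H (2 * (r + 1) + 1) + P, hp.add hP, hcomm.add_right hc, ?_⟩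
    change H * fibMatrix H (2 * (r + 1) + 1) + fibMatrix H (2 * r + 2) = _
    rw [hPe, Matrix.mul_add]

theorem mulVec_eq_zero_of_fibMatrix (H : Matrix ι ι ℝ) (hH : H.transpose = H) {n : ℕ} (hn : Odd n)
    (a : ι → ℝ) (ha : ∀ v, a ⬝ᵥ (fibMatrix H (n + 1)).mulVec v = 0) : H.mulVec a = 0 := by
  obtain ⟨r, rfl⟩ := hn
  obtain ⟨-, P, hP, hc, hPe⟩ := posDef_fibMatrix H hH r
  have h0 := ha a
  -- This choice turns the hypothesis into `(H a) ⬝ᵥ P (H a) = 0`.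
  have hz := ha (H.mulVec a)
  rw [show 2 * r + 1 + 1 = 2 * r + 2 from rfl, hPe, ← Matrix.mulVec_mulVec,
    Matrix.dotProduct_mulVec, ← Matrix.mulVec_transpose, hH] at hz
  by_contra hne
  have := hP.dotProduct_mulVec_pos hne
  simp only [star_trivial] at this
  linarith

end Fibonacci

/-! ### Linear relations between the boundary entries -/

section BoundaryEntries

/-- The symmetric matrix that describes how a fermion moves through one row. -/
def rowMatrix (m : ℕ) : Matrix (Fin m) (Fin m) ℝ := fun a b =>
  (-1) ^ ((a : ℕ) + 1) * ((if (b : ℕ) + 1 = a then 1 else 0) - if (a : ℕ) + 1 = b then 1 else 0)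

theorem rowMatrix_transpose (m : ℕ) : (rowMatrix m).transpose = rowMatrix m := by
  ext a b
  simp only [Matrix.transpose_apply, rowMatrix]
  by_cases h : (b : ℕ) + 1 = a
  · rw [if_pos h, if_neg (by omega), ← h]; ring
  · by_cases h' : (a : ℕ) + 1 = b
    · rw [if_pos h', if_neg h, ← h']; ring
    · rw [if_neg h, if_neg h']; ring

/-- Extension of a vector by zero. -/
def zeroExtend {R : Type*} [Zero R] {m : ℕ} (v : Fin m → R) (k : ℕ) : R :=
  if h : k < m then v ⟨k, h⟩ else 0

theorem sum_ite_val_eq {m : ℕ} (v : Fin m → ℝ) (k : ℕ) :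
    ∑ b : Fin m, (if (b : ℕ) = k then v b else 0) = zeroExtend v k := by
  unfold zeroExtend
  split_ifs with h
  · rw [Finset.sum_eq_single ⟨k, h⟩] <;> simp +contextual [Fin.ext_iff]
  · exact Finset.sum_eq_zero fun b _ => if_neg (by omega)

theorem rowMatrix_mulVec (m : ℕ) (v : Fin m → ℝ) (a : Fin m) :
    (rowMatrix m).mulVec v a =
      (-1) ^ ((a : ℕ) + 1) * (leftValue (zeroExtend v) a - zeroExtend v (a + 1)) := by
  simp only [Matrix.mulVec, dotProduct, rowMatrix, mul_assoc, ← Finset.mul_sum, sub_mul, ite_mul,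
    one_mul, zero_mul, Finset.sum_sub_distrib]
  congr 2
  · unfold leftValue
    split_ifs with h
    · exact Finset.sum_eq_zero fun b _ => if_neg (by omega)
    · rw [← sum_ite_val_eq]
      exact Finset.sum_congr rfl fun b _ => if_congr (by omega) rfl rfl
  · rw [← sum_ite_val_eq]
    exact Finset.sum_congr rfl fun b _ => if_congr (by omega) rfl rfl

/-- The creation coefficients are the previous annihilation coefficients up to sign, so the one-row
rule becomes the second-order Fibonacci recursion. Only the nonvanishing of the scalar matters. -/
theorem barMatrix_pow_mul_fermion (m : ℕ) (v : Fin m → ℝ) : ∀ n : ℕ,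
    ∃ c : ℝ, c ≠ 0 ∧ barMatrix 0 1 1 m ^ n * fermion (zeroExtend v) 0 m =
      c • (fermion (zeroExtend ((fibMatrix (rowMatrix m) (n + 1)).mulVec v))
        (fun k => (-1) ^ (k + 1) * zeroExtend ((fibMatrix (rowMatrix m) n).mulVec v) k) m *
          barMatrix 0 1 1 m ^ n)
  | 0 => by
    refine ⟨1, one_ne_zero, ?_⟩
    simp only [pow_zero, one_mul, mul_one, one_smul, fibMatrix, Matrix.one_mulVec, Matrix.zero_mulVec]
    refine fermion_congr (fun _ _ => by simp) (fun k hk => by simp [zeroExtend])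
  | n + 1 => by
    obtain ⟨c, hc, h⟩ := barMatrix_pow_mul_fermion m v n
    refine ⟨c * (-1) ^ m, mul_ne_zero hc (pow_ne_zero _ (by norm_num)), ?_⟩
    rw [pow_succ', mul_assoc, h, Matrix.mul_smul, ← mul_assoc, barMatrix_mul_fermion m _ _
      (zeroExtend ((fibMatrix (rowMatrix m) (n + 2)).mulVec v))
      (fun k => (-1) ^ (k + 1) * zeroExtend ((fibMatrix (rowMatrix m) (n + 1)).mulVec v) k)
      (by simp [zeroExtend]) _ (fun _ _ => rfl), Matrix.smul_mul, smul_smul, mul_assoc]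
    intro k hk
    have := rowMatrix_mulVec m ((fibMatrix (rowMatrix m) (n + 1)).mulVec v) ⟨k, hk⟩
    have e : zeroExtend ((fibMatrix (rowMatrix m) (n + 2)).mulVec v) k =
        (rowMatrix m).mulVec ((fibMatrix (rowMatrix m) (n + 1)).mulVec v) ⟨k, hk⟩ +
          zeroExtend ((fibMatrix (rowMatrix m) n).mulVec v) k := by
      simp [zeroExtend, hk, fibMatrix, Matrix.add_mulVec, Matrix.mulVec_mulVec]
    -- The alternating sign occurs in both coefficient rules and squares to one, leaving the bare
    -- previous vector.
    have hs : ((-1 : ℝ) ^ (k + 1)) * (-1) ^ (k + 1) = 1 := by rw [← mul_pow]; simp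
    rw [e, this]
    simp only
    linear_combination (-zeroExtend ((fibMatrix (rowMatrix m) n).mulVec v) k) * hs

/-- The entries of `A ^ n` in the first column and the rows `2 ^ k`. -/
noncomputable def boundaryEntry (m n : ℕ) (k : Fin m) : ℝ :=
  (barMatrix (0 : ℝ) 1 1 m ^ n) (powIndex m k k.2) (firstIndex m)

theorem boundaryEntry_dotProduct (m n : ℕ) (v : Fin m → ℝ) :
    boundaryEntry m n ⬝ᵥ (fibMatrix (rowMatrix m) (n + 1)).mulVec v = 0 := by
  obtain ⟨c, hc, h⟩ := barMatrix_pow_mul_fermion m v n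
  have h00 := congrFun (congrFun h (firstIndex m)) (firstIndex m)
  -- Pure annihilators kill the empty state, so the left side vanishes.
  rw [Matrix.mul_apply, Finset.sum_eq_zero fun j _ => by
    rw [fermion_zero_apply_firstIndex, mul_zero]] at h00
  have hz := (mul_eq_zero.mp h00.symm).resolve_left hc
  rw [Matrix.mul_apply] at hz
  have hf := sum_fermion_firstIndex_mul (zeroExtend ((fibMatrix (rowMatrix m) (n + 1)).mulVec v))
    (fun k => (-1) ^ (k + 1) * zeroExtend ((fibMatrix (rowMatrix m) n).mulVec v) k)
    (zeroExtend fun j => (barMatrix (0 : ℝ) 1 1 m ^ n) j (firstIndex m)) m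
  have e : ∀ j : Fin (2 ^ m), zeroExtend (fun j => (barMatrix (0 : ℝ) 1 1 m ^ n) j (firstIndex m)) j =
      (barMatrix (0 : ℝ) 1 1 m ^ n) j (firstIndex m) := fun j => by simp [zeroExtend]
  simp only [e, hz] at hf
  rw [hf, Finset.sum_range, dotProduct]
  refine Finset.sum_congr rfl fun k _ => ?_
  have hk : 2 ^ (k : ℕ) < 2 ^ m := Nat.pow_lt_pow_right one_lt_two k.2
  simp [zeroExtend, boundaryEntry, powIndex, mul_comm]
  exact fun h => absurd h hk.not_ge

theorem boundaryEntry_eq_corner {m n : ℕ} (hm : Odd m) (hn : Odd n) : ∀ k : ℕ, Even k →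
    ∀ hk : k < m, boundaryEntry m n ⟨k, hk⟩ = boundaryEntry m n ⟨0, hm.pos⟩ := by
  have h := mulVec_eq_zero_of_fibMatrix (rowMatrix m) (rowMatrix_transpose m) hn (boundaryEntry m n)
    (boundaryEntry_dotProduct m n)
  rintro k ⟨j, rfl⟩
  induction j with
  | zero => intro hk; rfl
  | succ j ih =>
    intro hk
    rw [← ih (by omega)]
    -- The kernel equation at the odd site `2j+1` compares its two even neighbours.
    have hj := congrFun h ⟨j + j + 1, by omega⟩
    rw [rowMatrix_mulVec] at hj
    have := (mul_eq_zero.mp hj).resolve_left (pow_ne_zero _ (by norm_num))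
    simp only [leftValue, zeroExtend, Nat.add_sub_cancel, Nat.add_eq_zero_iff, one_ne_zero,
      and_false, if_false] at this
    rw [dif_pos (by omega), dif_pos (by omega)] at this
    rw [sub_eq_zero] at this
    rw [this]
    congr 2
    omega

end BoundaryEntries

/-! ### Dimer coverings of vertex sets -/

section DimerCovers

variable {V : Type*}

/-- The dimer coverings of the set `W` of vertices. -/
def dimerCovers (G : SimpleGraph V) (W : Set V) : Set (Set (Sym2 V)) :=
  {D | IsMonomerDimerCovering G D ∧ monomers D = Wᶜ}

/-- The number of dimer coverings of the set `W` of vertices. -/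
noncomputable def dimerCount (G : SimpleGraph V) (W : Set V) : ℕ := (dimerCovers G W).ncard

theorem mem_dimerCovers {G : SimpleGraph V} {W : Set V} {D : Set (Sym2 V)} :
    D ∈ dimerCovers G W ↔ D ⊆ G.edgeSet ∧ (∀ w, ∀ d ∈ D, ∀ e ∈ D, w ∈ d → w ∈ e → d = e) ∧
      ∀ w, w ∈ W ↔ ∃ d ∈ D, w ∈ d := by
  simp only [dimerCovers, IsMonomerDimerCovering, monomers, Set.mem_ofPred_eq, and_assoc,
    Set.ext_iff, Set.mem_compl_iff]
  refine and_congr_right fun _ => and_congr_right fun _ => forall_congr' fun w => ?_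
  have h : (∀ d ∈ D, w ∉ d) ↔ ¬∃ d ∈ D, w ∈ d := by
    push Not
    rfl
  rw [h, not_iff_not]
  exact iff_comm

theorem dimerCount_empty (G : SimpleGraph V) : dimerCount G ∅ = 1 := by
  rw [dimerCount, Set.ncard_eq_one]
  refine ⟨∅, Set.eq_singleton_iff_unique_mem.mpr ⟨by simp [mem_dimerCovers], fun D hD => ?_⟩⟩
  rw [mem_dimerCovers] at hD
  refine Set.eq_empty_of_forall_notMem fun d hd => ?_
  induction d with
  | h a b => exact (hD.2.2 a).mpr ⟨_, hd, by simp⟩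

/-- Sort the coverings by the partner of `w` and remove that dimer. -/
theorem dimerCovers_eq_biUnion (G : SimpleGraph V) {W : Set V} {w : V} (hw : w ∈ W) :
    dimerCovers G W = ⋃ i ∈ {i | G.Adj w i ∧ i ∈ W},
      (fun D => insert s(w, i) D) '' dimerCovers G (W \ {w, i}) := by
  ext D
  simp only [Set.mem_iUnion, Set.mem_image, exists_prop, Set.mem_ofPred_eq]
  constructor
  · intro hD
    rw [mem_dimerCovers] at hD
    obtain ⟨hE, hU, hC⟩ := hD
    obtain ⟨d, hd, hwd⟩ := (hC w).mp hw
    obtain ⟨i, rfl⟩ := Sym2.mem_iff_exists.mp hwd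
    refine ⟨i, ⟨hE hd, (hC i).mpr ⟨_, hd, by simp⟩⟩, D \ {s(w, i)}, ?_, ?_⟩
    · rw [mem_dimerCovers]
      refine ⟨fun e he => hE he.1, fun v d hd e he => hU v d hd.1 e he.1, fun v => ?_⟩
      simp only [Set.mem_sdiff, Set.mem_insert_iff, Set.mem_singleton_iff, hC v]
      constructor
      · rintro ⟨⟨e, he, hv⟩, hne⟩
        refine ⟨e, ⟨he, ?_⟩, hv⟩
        rintro rfl
        exact hne (Sym2.mem_iff.mp hv)
      · rintro ⟨e, ⟨he, hne⟩, hv⟩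
        refine ⟨⟨e, he, hv⟩, fun h => hne (hU v e he _ hd hv (Sym2.mem_iff.mpr h))⟩
    · exact Set.insert_sdiff_self_of_mem hd
  · rintro ⟨i, ⟨hadj, hi⟩, D, hD, rfl⟩
    rw [mem_dimerCovers] at hD ⊢
    obtain ⟨hE, hU, hC⟩ := hD
    have key : ∀ v, v ∈ s(w, i) → ∀ e ∈ D, v ∉ e := fun v hv e he hve =>
      ((hC v).mpr ⟨e, he, hve⟩).2 (Sym2.mem_iff.mp hv)
    refine ⟨Set.insert_subset hadj hE, ?_, fun v => ?_⟩
    · rintro v d (rfl | hd) e (rfl | he) hvd hve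
      · rfl
      · exact absurd hve (key v hvd e he)
      · exact absurd hvd (key v hve d hd)
      · exact hU v d hd e he hvd hve
    · simp only [Set.mem_insert_iff, exists_eq_or_imp, ← hC v, Sym2.mem_iff, Set.mem_sdiff,
        Set.mem_singleton_iff]
      constructor
      · intro hv
        tauto
      · rintro ((rfl | rfl) | h)
        exacts [hw, hi, h.1]

theorem dimerCount_eq_finsum [Finite V] (G : SimpleGraph V) {W : Set V} {w : V} (hw : w ∈ W) :
    dimerCount G W = ∑ᶠ i ∈ {i | G.Adj w i ∧ i ∈ W}, dimerCount G (W \ {w, i}) := by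
  have : Finite (Sym2 V) := inferInstance
  have hnot : ∀ i, ∀ D ∈ dimerCovers G (W \ {w, i}), s(w, i) ∉ D := fun i D hD h =>
    (((mem_dimerCovers.mp hD).2.2 w).mpr ⟨_, h, by simp⟩).2 (by simp)
  rw [dimerCount, dimerCovers_eq_biUnion G hw, Set.Finite.ncard_biUnion (Set.toFinite _)
    (fun _ _ => Set.toFinite _)]
  · refine finsum_mem_congr rfl fun i _ => Set.InjOn.ncard_image fun D hD E hE h => ?_
    have h' : insert s(w, i) D = insert s(w, i) E := h
    rw [← Set.insert_sdiff_self_of_notMem (hnot i D hD), h',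
      Set.insert_sdiff_self_of_notMem (hnot i E hE)]
  · intro i hi j hj hij
    refine Set.disjoint_left.mpr fun D hDi hDj => hij ?_
    have hD : D ∈ dimerCovers G W := by
      rw [dimerCovers_eq_biUnion G hw]
      exact Set.mem_biUnion hi hDi
    obtain ⟨D₁, -, rfl⟩ := hDi
    obtain ⟨D₂, -, h⟩ := hDj
    have h' : insert s(w, j) D₂ = insert s(w, i) D₁ := h
    have hj' : s(w, j) ∈ insert s(w, i) D₁ := h' ▸ Set.mem_insert _ _
    have := (mem_dimerCovers.mp hD).2.1 w s(w, i) (Set.mem_insert _ _) s(w, j) hj' (by simp) (by simp)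
    exact Sym2.congr_right.mp this

theorem dimerCovers_iso {V' : Type*} {G : SimpleGraph V} {G' : SimpleGraph V'} (φ : G ≃g G')
    (W : Set V) {D : Set (Sym2 V)} (hD : D ∈ dimerCovers G W) :
    Sym2.map φ '' D ∈ dimerCovers G' (φ '' W) := by
  rw [mem_dimerCovers] at hD ⊢
  obtain ⟨hE, hU, hC⟩ := hD
  refine ⟨?_, ?_, ?_⟩
  · rintro _ ⟨d, hd, rfl⟩
    have := hE hd
    induction d with
    | h a b => exact φ.map_adj_iff.mpr this
  · rintro v _ ⟨d, hd, rfl⟩ _ ⟨e, he, rfl⟩ hvd hve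
    obtain ⟨a, ha, rfl⟩ := Sym2.mem_map.mp hvd
    obtain ⟨b, hb, hab⟩ := Sym2.mem_map.mp hve
    rw [φ.injective hab] at hb
    rw [hU a d hd e he ha hb]
  · intro v
    constructor
    · rintro ⟨a, ha, rfl⟩
      obtain ⟨d, hd, had⟩ := (hC a).mp ha
      exact ⟨_, ⟨d, hd, rfl⟩, Sym2.mem_map.mpr ⟨a, had, rfl⟩⟩
    · rintro ⟨_, ⟨d, hd, rfl⟩, hv⟩
      obtain ⟨a, ha, rfl⟩ := Sym2.mem_map.mp hv
      exact ⟨a, (hC a).mpr ⟨d, hd, ha⟩, rfl⟩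

theorem dimerCount_iso {V' : Type*} [Finite V] [Finite V'] {G : SimpleGraph V} {G' : SimpleGraph V'}
    (φ : G ≃g G') (W : Set V) : dimerCount G' (φ '' W) = dimerCount G W := by
  have le' : dimerCount G' (φ '' W) ≤ dimerCount G (φ.symm '' (φ '' W)) :=
    Set.ncard_le_ncard_of_injOn _ (fun D hD => dimerCovers_iso φ.symm _ hD)
      ((Set.image_injective.mpr (Sym2.map.injective φ.symm.injective)).injOn) (Set.toFinite _)
  have le'' : dimerCount G W ≤ dimerCount G' (φ '' W) :=
    Set.ncard_le_ncard_of_injOn _ (fun D hD => dimerCovers_iso φ W hD)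
      ((Set.image_injective.mpr (Sym2.map.injective φ.injective)).injOn) (Set.toFinite _)
  refine le_antisymm (le'.trans_eq ?_) le''
  rw [Set.image_image]
  simp

end DimerCovers

/-! ### Counting coverings of the grid site by site -/

section Profiles

theorem grid_adj {m n : ℕ} (p q : Fin m × Fin n) : (grid m n).Adj p q ↔
    ((p.1 : ℕ) + 1 = q.1 ∨ (q.1 : ℕ) + 1 = p.1) ∧ (p.2 : ℕ) = q.2 ∨
    ((p.2 : ℕ) + 1 = q.2 ∨ (q.2 : ℕ) + 1 = p.2) ∧ (p.1 : ℕ) = q.1 := by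
  simp only [grid, SimpleGraph.boxProd_adj, SimpleGraph.pathGraph_adj, Fin.ext_iff]

/-- The first `r` rows except for the sites of the last of them in the columns in `T`, together
with the sites of the next row in the first `c` columns except for those in the columns in `S`. -/
def profile (m n r c : ℕ) (S T : Set ℕ) : Set (Fin m × Fin n) :=
  {q | (q.2 : ℕ) + 1 < r ∨ ((q.2 : ℕ) + 1 = r ∧ (q.1 : ℕ) ∉ T) ∨
    ((q.2 : ℕ) = r ∧ (q.1 : ℕ) < c ∧ (q.1 : ℕ) ∉ S)}

open Classical in
/-- The number of dimer coverings of a profile. Sites cannot be missing from a row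
below the grid. -/
noncomputable def profileCount (m n r c : ℕ) (S T : Set ℕ) : ℕ :=
  if r = 0 ∧ T.Nonempty then 0 else dimerCount (grid m n) (profile m n r c S T)

variable {m n : ℕ}

theorem profileCount_congr {r c : ℕ} {S S' T : Set ℕ} (h : ∀ j < c, j ∈ S ↔ j ∈ S') :
    profileCount m n r c S T = profileCount m n r c S' T := by
  have : profile m n r c S T = profile m n r c S' T := by
    ext q
    simp only [profile, Set.mem_ofPred_eq]
    have := h q.1
    tauto
  rw [profileCount, profileCount, this]

/-- A completed row becomes the last full row, and its gaps take the role of `T`. -/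
theorem profileCount_full_row (r : ℕ) (S : Set ℕ) :
    profileCount m n r m S ∅ = profileCount m n (r + 1) 0 ∅ S := by
  have : profile m n r m S ∅ = profile m n (r + 1) 0 ∅ S := by
    ext ⟨a, b⟩
    simp only [profile, Set.mem_ofPred_eq, Set.mem_empty_iff_false, not_false_eq_true, a.2]
    by_cases ha : (a : ℕ) ∈ S <;> simp [ha] <;> omega
  rw [profileCount, profileCount, this]
  simp

theorem profileCount_zero_zero : profileCount m n 0 0 ∅ ∅ = 1 := by
  rw [profileCount, if_neg (by simp), ← dimerCount_empty (grid m n)]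
  congr 1
  ext q
  simp [profile]

theorem profileCount_of_mem {r k : ℕ} {S T : Set ℕ} (hS : k ∈ S) :
    profileCount m n r (k + 1) S T = profileCount m n r k S T := by
  have : profile m n r (k + 1) S T = profile m n r k S T := by
    ext ⟨a, b⟩
    simp only [profile, Set.mem_ofPred_eq]
    by_cases ha : (a : ℕ) = k
    · simp [ha, hS]
    · have : (a : ℕ) < k + 1 ↔ (a : ℕ) < k := by omega
      rw [this]
  rw [profileCount, profileCount, this]

-- The newest site pairs either downwards, opening a gap in the row below, or with its left
-- neighbour if that is present.
open Classical in
theorem profileCount_of_notMem {r k : ℕ} (hr : r < n) (hk : k < m) {S T : Set ℕ} (hS : k ∉ S)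
    (hT : k ∉ T) : profileCount m n r (k + 1) S T = profileCount m n r k S (insert k T) +
      if 0 < k ∧ k - 1 ∉ S then profileCount m n r (k - 1) S T else 0 := by
  by_cases h0 : r = 0 ∧ T.Nonempty
  · simp [profileCount, h0]
  have hw : ((⟨k, hk⟩, ⟨r, hr⟩) : Fin m × Fin n) ∈ profile m n r (k + 1) S T := by
    simp [profile, hS]
  have hN : {i | (grid m n).Adj (⟨k, hk⟩, ⟨r, hr⟩) i ∧ i ∈ profile m n r (k + 1) S T} =
      {q | (q.1 : ℕ) = k ∧ (q.2 : ℕ) + 1 = r} ∪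
        {q | (q.1 : ℕ) + 1 = k ∧ (q.2 : ℕ) = r ∧ (q.1 : ℕ) ∉ S} := by
    ext ⟨a, b⟩
    simp only [grid_adj, profile, Set.mem_ofPred_eq, Set.mem_union]
    by_cases ha : (a : ℕ) = k
    · simp only [ha, hT, hS]
      simp
      omega
    · by_cases ha' : (a : ℕ) ∈ S <;> by_cases ha'' : (a : ℕ) ∈ T <;>
        simp only [ha', ha''] <;> simp <;> omega
  rw [profileCount, if_neg h0, dimerCount_eq_finsum _ hw, hN, finsum_mem_union
    (Set.disjoint_left.mpr fun q hq hq' => by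
      simp only [Set.mem_ofPred_eq] at hq hq'; omega) (Set.toFinite _) (Set.toFinite _)]
  congr 1
  · rcases r with - | r
    · simp [profileCount]
    · have : {q : Fin m × Fin n | (q.1 : ℕ) = k ∧ (q.2 : ℕ) + 1 = r + 1} =
          {(⟨k, hk⟩, ⟨r, by omega⟩)} := by
        ext ⟨a, b⟩
        simp [Fin.ext_iff]
      rw [this, finsum_mem_singleton, profileCount, if_neg (by simp)]
      congr 1
      ext ⟨a, b⟩
      simp only [profile, Set.mem_sdiff, Set.mem_insert_iff, Set.mem_singleton_iff, Prod.mk.injEq,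
        Fin.ext_iff, Set.mem_ofPred_eq]
      by_cases ha : (a : ℕ) = k
      · simp only [ha, hT, hS]
        simp
        omega
      · by_cases ha' : (a : ℕ) ∈ S <;> by_cases ha'' : (a : ℕ) ∈ T <;>
          simp only [ha, ha', ha''] <;> simp <;> omega
  · split_ifs with h
    · obtain ⟨j, rfl⟩ : ∃ j, k = j + 1 := ⟨k - 1, by omega⟩
      rw [Nat.add_sub_cancel] at h ⊢
      have : {q : Fin m × Fin n | (q.1 : ℕ) + 1 = j + 1 ∧ (q.2 : ℕ) = r ∧ (q.1 : ℕ) ∉ S} =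
          {(⟨j, by omega⟩, ⟨r, hr⟩)} := by
        ext ⟨a, b⟩
        simp only [Set.mem_ofPred_eq, Set.mem_singleton_iff, Prod.mk.injEq, Fin.ext_iff,
          Nat.add_right_cancel_iff]
        constructor
        · exact fun h => ⟨h.1, h.2.1⟩
        · rintro ⟨h1, h2⟩
          exact ⟨h1, h2, h1 ▸ h.2⟩
      rw [this, finsum_mem_singleton, profileCount, if_neg h0]
      congr 1
      ext ⟨a, b⟩
      simp only [profile, Set.mem_sdiff, Set.mem_insert_iff, Set.mem_singleton_iff, Prod.mk.injEq,
        Fin.ext_iff, Set.mem_ofPred_eq]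
      by_cases ha' : (a : ℕ) ∈ S <;> by_cases ha'' : (a : ℕ) ∈ T <;>
        simp only [ha', ha''] <;> simp <;> omega
    · rw [finsum_mem_eq_zero_of_forall_eq_zero]
      intro q hq
      simp only [Set.mem_ofPred_eq] at hq
      exact absurd ⟨by omega, by rw [← hq.1]; simpa using hq.2.2⟩ h

/-- The positions of the digits `1` in the binary expansion of a number. -/
def bitSet (s : ℕ) : Set ℕ := {j | s.testBit j = true}

theorem bitSet_zero : bitSet 0 = ∅ := by
  ext; simp [bitSet]

theorem bitSet_two_pow (k : ℕ) : bitSet (2 ^ k) = {k} := by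
  ext j
  simp [bitSet, Nat.testBit_two_pow, eq_comm]

theorem lt_of_mem_bitSet {s k j : ℕ} (hs : s < 2 ^ k) (hj : j ∈ bitSet s) : j < k := by
  by_contra h
  have : s.testBit j = false :=
    Nat.testBit_lt_two_pow (hs.trans_le (Nat.pow_le_pow_right two_pos (not_lt.mp h)))
  simp [bitSet, this] at hj

theorem bitSet_two_pow_add {s k : ℕ} (hs : s < 2 ^ k) :
    bitSet (2 ^ k + s) = insert k (bitSet s) := by
  ext j
  simp only [bitSet, Set.mem_ofPred_eq, Set.mem_insert_iff]
  rcases lt_trichotomy j k with h | rfl | h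
  · rw [Nat.testBit_two_pow_add_gt h]
    simp [h.ne]
  · simp [Nat.testBit_two_pow_add_eq, Nat.testBit_lt_two_pow hs]
  · have h2 : 2 ^ k + s < 2 ^ j := by
      have := Nat.pow_le_pow_right two_pos h
      rw [Nat.pow_succ] at this
      omega
    rw [Nat.testBit_lt_two_pow h2, Nat.testBit_lt_two_pow (by omega)]
    simp [h.ne']

theorem bitSet_nonempty {s : ℕ} (hs : s ≠ 0) : (bitSet s).Nonempty :=
  Nat.exists_testBit_of_ne_zero hs

/-- The block recursion mirrors the choices at the last site: a vertical dimer sets its digit in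
`t`, the corner block is a horizontal dimer. The latter uses up two columns, hence strong induction.
`T` records gaps already made in columns from `c` on. -/
theorem profileCount_eq_sum {r : ℕ} (hr : r < n) : ∀ c ≤ m, ∀ (s : Fin (2 ^ c)) (T : Set ℕ),
    (∀ j ∈ T, c ≤ j) → (profileCount m n r c (bitSet s) T : ℝ) =
      ∑ t : Fin (2 ^ c), barMatrix (0 : ℝ) 1 1 c s t *
        profileCount m n r 0 ∅ (bitSet t ∪ T) := by
  intro c
  induction c using Nat.strong_induction_on with | _ c ih
  intro hc s T hT
  rcases c with - | k
  · fin_cases s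
    simp [barMatrix, bitSet_zero]
  · have hkT : k ∉ T := fun h => by have := hT k h; omega
    obtain ⟨s, rfl⟩ := (halves k).surjective s
    rw [sum_halves, barMatrix_succ]
    rcases s with s | s
    · have hks : k ∉ bitSet s := fun h => lt_irrefl k (lt_of_mem_bitSet s.2 h)
      simp only [blocks_apply_inl_inl, blocks_apply_inl_inr, halves_inl_val, halves_inr_val]
      rw [profileCount_of_notMem hr hc hks hkT, add_comm, Nat.cast_add]
      congr 1
      · rcases k with - | j
        · simp [cornerBlock]
        · obtain ⟨s, rfl⟩ := (halves j).surjective s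
          rw [sum_halves, cornerBlock]
          rcases s with s | s
          · have hjs : j ∉ bitSet s := fun h => lt_irrefl j (lt_of_mem_bitSet s.2 h)
            simp only [blocks_apply_inl_inl, blocks_apply_inl_inr, halves_inl_val, Matrix.zero_apply,
              zero_mul, Finset.sum_const_zero, add_zero]
            rw [if_pos ⟨by omega, hjs⟩]
            exact ih j (by omega) (by omega) s T (fun i hi => by have := hT i hi; omega)
          · simp only [blocks_apply_inr_inl, blocks_apply_inr_inr, halves_inr_val, Matrix.zero_apply,
              zero_mul, Finset.sum_const_zero, add_zero]
            rw [if_neg fun h => h.2 (by rw [halves_inr_val, bitSet_two_pow_add s.2]; exact Set.mem_insert _ _)]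
            simp
      · rw [ih k (by omega) (by omega) s (insert k T) (by
          rintro j (rfl | hj)
          · rfl
          · have := hT j hj; omega)]
        refine Finset.sum_congr rfl fun t _ => ?_
        rw [bitSet_two_pow_add t.2, Set.union_insert, Set.insert_union]
    · simp only [blocks_apply_inr_inl, blocks_apply_inr_inr, halves_inl_val, halves_inr_val,
        Matrix.zero_apply, zero_mul, Finset.sum_const_zero, add_zero]
      rw [bitSet_two_pow_add s.2, profileCount_of_mem (Set.mem_insert _ _),
        profileCount_congr (S' := bitSet s) (fun j hj => by simp [hj.ne])]
      exact ih k (by omega) (by omega) s T (fun i hi => by have := hT i hi; omega)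

theorem profileCount_eq_barMatrix_pow : ∀ r ≤ n, ∀ s : Fin (2 ^ m),
    (profileCount m n r 0 ∅ (bitSet s) : ℝ) = (barMatrix (0 : ℝ) 1 1 m ^ r) s (firstIndex m)
  | 0, _, s => by
    rw [pow_zero, Matrix.one_apply]
    split_ifs with h
    · rw [h, firstIndex, bitSet_zero, profileCount_zero_zero, Nat.cast_one]
    · have : (s : ℕ) ≠ 0 := fun h' => h (Fin.ext h')
      simp [profileCount, bitSet_nonempty this]
  | r + 1, hr, s => by
    rw [← profileCount_full_row, profileCount_eq_sum (by omega) m le_rfl s ∅ (by simp), pow_succ',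
      Matrix.mul_apply]
    refine Finset.sum_congr rfl fun t _ => ?_
    rw [Set.union_empty, profileCount_eq_barMatrix_pow r (by omega) t]

theorem singleMonomerCount_eq_dimerCount (p : Fin m × Fin n) :
    singleMonomerCount m n p = dimerCount (grid m n) {p}ᶜ := by
  simp [singleMonomerCount, dimerCount, dimerCovers]

theorem singleMonomerCount_iso {m' n' : ℕ} (φ : grid m n ≃g grid m' n') (p : Fin m × Fin n) :
    singleMonomerCount m' n' (φ p) = singleMonomerCount m n p := by
  rw [singleMonomerCount_eq_dimerCount, singleMonomerCount_eq_dimerCount, ← dimerCount_iso φ,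
    Set.image_compl_eq φ.bijective, Set.image_singleton]

theorem singleMonomerCount_swap (p : Fin m × Fin n) :
    singleMonomerCount n m p.swap = singleMonomerCount m n p :=
  singleMonomerCount_iso (SimpleGraph.boxProdComm _ _) p

/-- The reflection of the grid that reverses the order of the rows. -/
def gridReflection (m n : ℕ) : grid m n ≃g grid m n where
  toEquiv := (Equiv.refl _).prodCongr Fin.revPerm
  map_rel_iff' := by
    rintro ⟨a, b⟩ ⟨c, d⟩
    simp only [grid_adj, Equiv.prodCongr_apply, Equiv.coe_refl, Prod.map_apply, id_eq,
      Fin.revPerm_apply, Fin.val_rev]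
    omega

theorem singleMonomerCount_last_row (p : Fin m × Fin n) (hp : (p.2 : ℕ) + 1 = n) :
    (singleMonomerCount m n p : ℝ) = boundaryEntry m n p.1 := by
  rw [boundaryEntry, ← profileCount_eq_barMatrix_pow n le_rfl, powIndex, bitSet_two_pow,
    profileCount, if_neg (by omega), singleMonomerCount_eq_dimerCount]
  congr 2
  ext ⟨a, b⟩
  obtain ⟨p, q⟩ := p
  simp only [profile, Set.mem_compl_iff, Set.mem_singleton_iff, Set.mem_ofPred_eq, Prod.mk.injEq,
    Fin.ext_iff] at hp ⊢
  omega

theorem singleMonomerCount_first_row (p : Fin m × Fin n) (hp : (p.2 : ℕ) = 0) :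
    (singleMonomerCount m n p : ℝ) = boundaryEntry m n p.1 := by
  rw [← singleMonomerCount_iso (gridReflection m n) p]
  refine singleMonomerCount_last_row _ ?_
  have := p.2.2
  simp [gridReflection, hp]
  omega

/-- The number of coverings with a single monomer on an outer row does not depend on its column,
as long as this is odd when counted from one. -/
theorem singleMonomerCount_outer_row (hm : Odd m) (hn : Odd n) (p : Fin m × Fin n)
    (hp : (p.2 : ℕ) = 0 ∨ (p.2 : ℕ) + 1 = n) (h : Odd ((p.1 : ℕ) + 1)) :
    (singleMonomerCount m n p : ℝ) = boundaryEntry m n ⟨0, hm.pos⟩ := by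
  rw [hp.elim (singleMonomerCount_first_row p) (singleMonomerCount_last_row p)]
  exact boundaryEntry_eq_corner hm hn p.1 (by simpa [Nat.odd_add_one] using h) p.1.2

theorem singleMonomerCount_boundary (hm : Odd m) (hn : Odd n) (p : Fin m × Fin n)
    (hb : IsBoundarySite p) (ho : HasOddCoordinates p) :
    (singleMonomerCount m n p : ℝ) = boundaryEntry m n ⟨0, hm.pos⟩ := by
  by_cases hp : (p.2 : ℕ) = 0 ∨ (p.2 : ℕ) + 1 = n
  · exact singleMonomerCount_outer_row hm hn p hp ho.1
  · have hp' : (p.1 : ℕ) = 0 ∨ (p.1 : ℕ) + 1 = m := by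
      unfold IsBoundarySite at hb
      tauto
    -- A side column is an outer row of the transposed grid; its corner count is then transposed
    -- back.
    rw [← singleMonomerCount_swap, singleMonomerCount_outer_row hn hm p.swap hp' ho.2,
      ← singleMonomerCount_first_row ((⟨0, hn.pos⟩, ⟨0, hm.pos⟩) : Fin n × Fin m) rfl,
      ← singleMonomerCount_swap, singleMonomerCount_first_row _ rfl]
    rfl

end Profiles

/-! ### Specialisation of the polynomials and conclusion -/

theorem eval_stateMatrix (m n : ℕ) (i j : Fin (2 ^ m)) :
    ((MvPolynomial.eval ![0, 1, 1] (stateMatrix m n i j) : ℤ) : ℝ) =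
      (barMatrix (0 : ℝ) 1 1 m ^ n) i j := by
  have h := barMatrix_map ((Int.castRingHom ℝ).comp (MvPolynomial.eval (![0, 1, 1] : Fin 3 → ℤ)))
    (MvPolynomial.X 0) (MvPolynomial.X 1) (MvPolynomial.X 2) m
  simp only [RingHom.comp_apply, MvPolynomial.eval_X] at h
  have h' : barMatrix (0 : ℝ) 1 1 m = ((Int.castRingHom ℝ).comp
      (MvPolynomial.eval (![0, 1, 1] : Fin 3 → ℤ))).mapMatrix (barMatrix (MvPolynomial.X 0)
        (MvPolynomial.X 1) (MvPolynomial.X 2) m) := by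
    rw [RingHom.mapMatrix_apply, h]
    simp
  rw [h', ← map_pow]
  rfl

theorem theorem3 (m n : ℕ) (hm : Odd m) (hn : Odd n)
    (p : Fin m × Fin n) (hbdry : IsBoundarySite p) (hodd : HasOddCoordinates p) :
    MvPolynomial.eval ![0, 1, 1] (singleMonomerPoly m n hm.pos) = (singleMonomerCount m n p : ℤ) ∧
    ∀ (k : ℕ) (hk : k < m), Even k →
      MvPolynomial.eval ![0, 1, 1] (stateMatrix m n (powIndex m k hk) (firstIndex m)) =
          (singleMonomerCount m n p : ℤ) ∧
      MvPolynomial.eval ![0, 1, 1] (stateMatrix m n (firstIndex m) (powIndex m k hk)) =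
          (singleMonomerCount m n p : ℤ) := by
  have hp := singleMonomerCount_boundary hm hn p hbdry hodd
  have key : ∀ (k : ℕ) (hk : k < m), Even k →
      (barMatrix (0 : ℝ) 1 1 m ^ n) (powIndex m k hk) (firstIndex m) = singleMonomerCount m n p :=
    fun k hk he => (boundaryEntry_eq_corner hm hn k he hk).trans hp.symm
  have hsymm : ∀ i j, (barMatrix (0 : ℝ) 1 1 m ^ n) i j = (barMatrix (0 : ℝ) 1 1 m ^ n) j i :=
    fun i j => by
      conv_lhs => rw [← barMatrix_transpose, ← Matrix.transpose_pow]
      rfl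
  refine ⟨?_, fun k hk he => ⟨?_, ?_⟩⟩
  · apply Int.cast_injective (α := ℝ)
    rw [singleMonomerPoly, eval_stateMatrix, Int.cast_natCast]
    exact key 0 hm.pos (by simp)
  · apply Int.cast_injective (α := ℝ)
    rw [eval_stateMatrix, key k hk he, Int.cast_natCast]
  · apply Int.cast_injective (α := ℝ)
    rw [eval_stateMatrix, hsymm, key k hk he, Int.cast_natCast]
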